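/- Let $(X,\|\cdot\|)$ be a real normed space with a modulus of uniform convexity $\eta:(0,2]\to(0,1]$, i.e. for all $\varepsilon\in(0,2]$ and $x,y\in X$ with $\|x\|,\|y\|\le 1$ and $\|x-y\|\ge\varepsilon$ one has $\|\tfrac12(x+y)\|\le 1-\eta(\varepsilon)$; extend $\eta$ to $(0,\infty)$ by any values in $(0,1]$ on $(2,\infty)$ (e.g. the value $1$). Let $C\subseteq X$ be convex and let $b>0$ satisfy $\|x\|\le b$ for all $x\in C$. For $z\in X$ let $J(z)=\{j\in X^*: j(z)=\|z\|^2=\|j\|^2\}$ (the normalized duality mapping). Let $T:C\to C$ be nonexpansive and such that $A:=I-T$ (with domain $C$) is uniformly accretive with modulus $\Omega:(0,\infty)^2\to(0,\infty)$, i.e. for all $x,y\in C$ and all $b',\varepsilon>0$ there is $j\in J(x-y)$ such that $$\max\{\|x\|,\|y\|\}\le b'\ \wedge\ \bigl|\|x\|-\|y\|\bigr|\ge\varepsilon\ \Longrightarrow\ j(Ax-Ay)>\Omega(\varepsilon,b').$$ Write $\Omega(\varepsilon):=\Omega(\varepsilon,b)$ and, for $\varepsilon>0$, put $$\omega_b(\varepsilon):=\frac1{16b}\,\Omega\!\left(\frac\varepsilon2\,\eta\!\left(\frac\varepsilon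 b\right)\right)\cdot\eta\!\left(\frac1{8b^2}\,\Omega\!\left(\frac\varepsilon2\,\eta\!\left(\frac\varepsilon b\right)\right)\right).$$ If $\eta(\varepsilon)=\varepsilon\,\tilde\eta(\varepsilon)$ on $(0,2]$ with $\tilde\eta$ nondecreasing, one may instead put $$\omega_b(\varepsilon):=\min\left\{b\,\eta\!\left(\frac{\Omega(b\,\eta(\varepsilon/b))}{8b^2}\right),\ \frac{\Omega(b\,\eta(\varepsilon/b))}{4b}\right\}.$$ Let $(\beta_n)_{n\ge0}\subset[0,1]$ be such that $\sum_{n=0}^\infty\beta_n(1-\beta_n)=\infty$ with rate of divergence $\gamma:\mathbb N\to\mathbb N$, i.e. $\sum_{i=0}^{\gamma(k)}\beta_i(1-\beta_i)\ge k$ for all $k\in\mathbb N$. For $x_0\in C$ define $x_{n+1}:=(1-\beta_n)x_n+\beta_nTx_n$. Then, for either choice of $\omega_b$, $(x_n)$ is a Cauchy sequence, with $$\forall\varepsilon>0\ \forall n,m\ge\gamma\!\left(\left\lceil\frac{4b^2}{\pi\,\omega_b(\varepsilon)^2}\right\rceil\right):\quad \|x_n-x_m\|\le\varepsilon .$$ If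 moreover $X$ is complete and $C$ is closed, then $T$ has a unique fixed point $p\in C$, $(x_n)$ converges to $p$, and $\|x_n-p\|\le\varepsilon$ for all $\varepsilon>0$ and all $n\ge\gamma\bigl(\bigl\lceil 4b^2/(\pi\,\omega_b(\varepsilon)^2)\bigr\rceil\bigr)$. -/

import Mathlib

open Set Filter Topology

/-- The normalized duality mapping `J : X → 2^(X*)` of a real normed space,
`J x = {j | ⟨x, j⟩ = ‖x‖² = ‖j‖²}`. -/
def normalizedDuality {X : Type*} [NormedAddCommGroup X] [NormedSpace ℝ X] (x : X) :
    Set (StrongDual ℝ X) :=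
  {j | j x = ‖x‖ ^ 2 ∧ ‖j‖ ^ 2 = ‖x‖ ^ 2}

/-- The graph of the single-valued operator `A = I - T` with domain `D(A) = C`. -/
def idSubGraph {X : Type*} [NormedAddCommGroup X] (T : X → X) (C : Set X) : Set (X × X) :=
  {p | p.1 ∈ C ∧ p.2 = p.1 - T p.1}

/-- `Ω : (0,∞)² → (0,∞)` is a modulus of uniform accretivity for the (possibly set-valued)
operator whose graph is `A`. -/
def IsUniformAccretivityModulus {X : Type*} [NormedAddCommGroup X] [NormedSpace ℝ X]
    (A : Set (X × X)) (Ω : ℝ → ℝ → ℝ) : Prop :=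
  (∀ ε > 0, ∀ b > 0, 0 < Ω ε b) ∧
  ∀ x u y v : X, (x, u) ∈ A → (y, v) ∈ A → ∀ b > 0, ∀ ε > 0,
    ∃ j ∈ normalizedDuality (x - y),
      max ‖x‖ ‖y‖ ≤ b ∧ ε ≤ |‖x‖ - ‖y‖| → Ω ε b < j (u - v)

/-- `η : (0,2] → (0,1]` is a modulus of uniform convexity of `X`. Beyond `2`, where the defining
implication would be vacuous, `η` is extended by arbitrary values in `(0,1]`. -/
def IsUniformConvexityModulus (X : Type*) [NormedAddCommGroup X] [NormedSpace ℝ X]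
    (η : ℝ → ℝ) : Prop :=
  (∀ ε > 0, η ε ∈ Ioc (0 : ℝ) 1) ∧
  ∀ ε ∈ Ioc (0 : ℝ) 2, ∀ x y : X, ‖x‖ ≤ 1 → ‖y‖ ≤ 1 → ε ≤ ‖x - y‖ →
    ‖(1 / 2 : ℝ) • (x + y)‖ ≤ 1 - η ε

/-- `η ε = ε * η' ε` on `(0,2]` with `η'` nondecreasing. -/
def HasMonotoneFactor (η : ℝ → ℝ) : Prop :=
  ∃ η' : ℝ → ℝ, (∀ ε ∈ Ioc (0 : ℝ) 2, η ε = ε * η' ε) ∧ MonotoneOn η' (Ioc (0 : ℝ) 2)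

/-- The modulus of uniqueness `ω_b`. -/
noncomputable def uniquenessModulus (η : ℝ → ℝ) (Ω : ℝ → ℝ → ℝ) (b ε : ℝ) : ℝ :=
  1 / (16 * b) * Ω (ε / 2 * η (ε / b)) b
    * η (1 / (8 * b ^ 2) * Ω (ε / 2 * η (ε / b)) b)

/-- The improved modulus of uniqueness `ω_b`, for `η` with a monotone factor. -/
noncomputable def improvedUniquenessModulus (η : ℝ → ℝ) (Ω : ℝ → ℝ → ℝ) (b ε : ℝ) : ℝ :=
  min (b * η (Ω (b * η (ε / b)) b / (8 * b ^ 2))) (Ω (b * η (ε / b)) b / (4 * b))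

/-- `γ` is a rate of divergence for `∑ a i = ∞`. -/
def IsDivergenceRate (γ : ℕ → ℕ) (a : ℕ → ℝ) : Prop :=
  ∀ k : ℕ, (k : ℝ) ≤ ∑ i ∈ Finset.range (γ k + 1), a i

/-- `ρ : (0,∞) → ℕ` is a Cauchy rate of the sequence `x`. -/
def IsCauchyRate {X : Type*} [NormedAddCommGroup X] (ρ : ℝ → ℕ) (x : ℕ → X) : Prop :=
  ∀ ε > 0, ∀ n ≥ ρ ε, ∀ m ≥ ρ ε, ‖x n - x m‖ ≤ ε

/-- `ρ : (0,∞) → ℕ` is a rate of convergence of the sequence `x` towards `p`. -/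
def IsConvergenceRate {X : Type*} [NormedAddCommGroup X] (ρ : ℝ → ℕ) (x : ℕ → X) (p : X) :
    Prop :=
  ∀ ε > 0, ∀ n ≥ ρ ε, ‖x n - p‖ ≤ ε

/-- The Krasnoselskii-Mann iteration `x (n+1) = (1 - β n) x n + β n T (x n)`, `x 0 = x₀`. -/
def krasnoselskiiMann {X : Type*} [NormedAddCommGroup X] [NormedSpace ℝ X]
    (T : X → X) (β : ℕ → ℝ) (x₀ : X) : ℕ → X
  | 0 => x₀
  | n + 1 => (1 - β n) • krasnoselskiiMann T β x₀ n + β n • T (krasnoselskiiMann T β x₀ n)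

/-- The rate `ε ↦ γ ⌈4b² / (π ω(ε)²)⌉`. -/
noncomputable def kmRate (γ : ℕ → ℕ) (b : ℝ) (ω : ℝ → ℝ) (ε : ℝ) : ℕ :=
  γ ⌈4 * b ^ 2 / (Real.pi * (ω ε) ^ 2)⌉₊

/-!
Let `x` be the Krasnoselskii-Mann iteration. Up to the diameter of `C`, the distances `‖x n - x m‖`
and `‖T (x n) - x m‖` are bounded by `E sign (k + U - D)` with `k = 0` and `k = 1`, where `U` and
`D` are independent sums of `n` and `m` independent Bernoulli variables of parameters `β i`. For
`n = m`, `U - D` is a lazy symmetric walk on `ℤ` with steps `±1` of probability `β i * (1 - β i)`,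
and Fourier inversion bounds its point masses by `√π / (4 * √(∑ β i * (1 - β i)))`. Hence
`‖x n - T (x n)‖` tends to zero at an explicit rate.

It remains to see that two points `x`, `y` with small displacement are close. If they were not,
uniform convexity would give their midpoint `z` a norm smaller than `max ‖x‖ ‖y‖` by a definite
amount, so accretivity would bound `‖z - T z‖` from below. But `T z` is nearly as close to `x` and
to `y` as `z` is, which by uniform convexity leaves it no room away from `z`.

The constant `√π / 2` in the residual bound is not the optimal `1 / √π` of Cominetti, Soto and
Vaisman. It suffices because `ω_b` still leaves a factor `2` to spare.
-/

/-- A modulus of uniqueness for the fixed points of `T` in `C`: any two `ω ε`-approximate fixed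
points are at distance at most `ε`. -/
def IsUniquenessModulus {X : Type*} [NormedAddCommGroup X] (T : X → X) (C : Set X)
    (ω : ℝ → ℝ) : Prop :=
  (∀ ε > 0, 0 < ω ε) ∧
  ∀ ε > 0, ∀ x ∈ C, ∀ y ∈ C, ‖x - T x‖ ≤ ω ε → ‖y - T y‖ ≤ ω ε → ‖x - y‖ ≤ ε

/-- The expectation of `sign (k + U - D)`, where `U` and `D` are sums of independent Bernoulli
variables with parameters `β 0, …, β (n - 1)` and `β 0, …, β (m - 1)` respectively. The recursion
conditions on the last variable. -/
noncomputable def expectedSign (β : ℕ → ℝ) : ℕ → ℕ → ℤ → ℝ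
  | 0, 0, k => (k.sign : ℝ)
  | 0, m + 1, k => (1 - β m) * expectedSign β 0 m k + β m * expectedSign β 0 m (k - 1)
  | n + 1, m, k => (1 - β n) * expectedSign β n m k + β n * expectedSign β n m (k + 1)

/-- The probability that the lazy symmetric walk on `ℤ` which starts at `0` and whose `i`-th step
is `1` or `-1`, each with probability `a i`, and `0` otherwise, is at `k` after `n` steps. -/
noncomputable def lazyWalkMass (a : ℕ → ℝ) : ℕ → ℤ → ℝ
  | 0, k => if k = 0 then 1 else 0
  | n + 1, k => (1 - 2 * a n) * lazyWalkMass a n k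
      + a n * (lazyWalkMass a n (k + 1) + lazyWalkMass a n (k - 1))

/-- The characteristic function of the lazy symmetric walk with step probabilities `a i`. It is
real because the walk is symmetric. -/
noncomputable def lazyWalkCharFun (a : ℕ → ℝ) (n : ℕ) (t : ℝ) : ℝ :=
  ∏ i ∈ Finset.range n, (1 - 2 * a i * (1 - Real.cos t))

section LazyWalk

variable {a : ℕ → ℝ} {n : ℕ}

theorem continuous_lazyWalkCharFun (a : ℕ → ℝ) (n : ℕ) : Continuous (lazyWalkCharFun a n) := by
  unfold lazyWalkCharFun
  fun_prop

theorem one_sub_two_mul_one_sub_cos_nonneg {p : ℝ} (hp : p ∈ Icc (0 : ℝ) (1 / 4)) (t : ℝ) :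
    0 ≤ 1 - 2 * p * (1 - Real.cos t) := by
  nlinarith [hp.1, hp.2, Real.neg_one_le_cos t]

theorem lazyWalkCharFun_nonneg (ha : ∀ i, a i ∈ Icc (0 : ℝ) (1 / 4)) (t : ℝ) :
    0 ≤ lazyWalkCharFun a n t :=
  Finset.prod_nonneg fun i _ ↦ one_sub_two_mul_one_sub_cos_nonneg (ha i) t

theorem lazyWalkCharFun_le_exp (ha : ∀ i, a i ∈ Icc (0 : ℝ) (1 / 4)) {t : ℝ}
    (ht : |t| ≤ Real.pi) :
    lazyWalkCharFun a n t ≤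
      Real.exp (-(4 * (∑ i ∈ Finset.range n, a i) / Real.pi ^ 2) * t ^ 2) := by
  have hσ : 0 ≤ ∑ i ∈ Finset.range n, a i := Finset.sum_nonneg fun i _ ↦ (ha i).1
  have hcos : 2 / Real.pi ^ 2 * t ^ 2 ≤ 1 - Real.cos t := by
    linarith [Real.cos_le_one_sub_mul_cos_sq ht]
  calc lazyWalkCharFun a n t
      ≤ ∏ i ∈ Finset.range n, Real.exp (-(2 * a i * (1 - Real.cos t))) :=
        Finset.prod_le_prod (fun i _ ↦ one_sub_two_mul_one_sub_cos_nonneg (ha i) t)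
          fun i _ ↦ Real.one_sub_le_exp_neg _
    _ = Real.exp (-(2 * (∑ i ∈ Finset.range n, a i) * (1 - Real.cos t))) := by
        rw [← Real.exp_sum, Finset.sum_neg_distrib, ← Finset.sum_mul, ← Finset.mul_sum]
    _ ≤ Real.exp (-(2 * (∑ i ∈ Finset.range n, a i) * (2 / Real.pi ^ 2 * t ^ 2))) := by gcongr
    _ = _ := by ring_nf

theorem integral_cos_int_mul (k : ℤ) :
    ∫ t in -Real.pi..Real.pi, Real.cos (k * t) = if k = 0 then 2 * Real.pi else 0 := by
  split_ifs with hk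
  · simp only [hk, Int.cast_zero, zero_mul, Real.cos_zero, intervalIntegral.integral_const,
      smul_eq_mul, mul_one]
    ring
  · have hk' : (k : ℝ) ≠ 0 := by exact_mod_cast hk
    rw [intervalIntegral.integral_comp_mul_left _ hk', integral_cos]
    simp [Real.sin_int_mul_pi]

theorem cos_add_one_mul_add_cos_sub_one_mul (c t : ℝ) :
    Real.cos ((c + 1) * t) + Real.cos ((c - 1) * t) = 2 * Real.cos t * Real.cos (c * t) := by
  rw [add_one_mul, sub_one_mul, Real.cos_add, Real.cos_sub]
  ring

theorem lazyWalkMass_eq_integral (a : ℕ → ℝ) (n : ℕ) (k : ℤ) :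
    lazyWalkMass a n k =
      1 / (2 * Real.pi) * ∫ t in -Real.pi..Real.pi, Real.cos (k * t) * lazyWalkCharFun a n t := by
  induction n generalizing k with
  | zero =>
    simp only [lazyWalkMass, lazyWalkCharFun, Finset.range_zero, Finset.prod_empty, mul_one,
      integral_cos_int_mul]
    split_ifs
    · field_simp
    · simp
  | succ n ih =>
    have hint (j : ℤ) : IntervalIntegrable (fun t ↦ Real.cos (j * t) * lazyWalkCharFun a n t)
        MeasureTheory.volume (-Real.pi) Real.pi :=
      ((by fun_prop : Continuous fun t : ℝ ↦ Real.cos (j * t)).mul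
        (continuous_lazyWalkCharFun a n)).intervalIntegrable _ _
    have hstep (t : ℝ) : Real.cos (k * t) * lazyWalkCharFun a (n + 1) t =
        (1 - 2 * a n) * (Real.cos (k * t) * lazyWalkCharFun a n t)
        + a n * (Real.cos ((k + 1 : ℤ) * t) * lazyWalkCharFun a n t
          + Real.cos ((k - 1 : ℤ) * t) * lazyWalkCharFun a n t) := by
      have hcos := cos_add_one_mul_add_cos_sub_one_mul k t
      rw [lazyWalkCharFun, Finset.prod_range_succ, ← lazyWalkCharFun]
      push_cast
      linear_combination -(a n * lazyWalkCharFun a n t) * hcos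
    simp only [hstep]
    rw [intervalIntegral.integral_add ((hint k).const_mul _)
        (((hint (k + 1)).add (hint (k - 1))).const_mul _),
      intervalIntegral.integral_const_mul, intervalIntegral.integral_const_mul,
      intervalIntegral.integral_add (hint (k + 1)) (hint (k - 1)), lazyWalkMass, ih, ih, ih]
    ring

theorem intervalIntegral_exp_neg_mul_sq_le {c r : ℝ} (hc : 0 < c) (hr : 0 ≤ r) :
    ∫ t in -r..r, Real.exp (-c * t ^ 2) ≤ √(Real.pi / c) := by
  rw [intervalIntegral.integral_of_le (by linarith), ← integral_gaussian]
  exact MeasureTheory.setIntegral_le_integral (integrable_exp_neg_mul_sq hc)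
    (MeasureTheory.ae_of_all _ fun _ ↦ (Real.exp_pos _).le)

theorem lazyWalkMass_le (ha : ∀ i, a i ∈ Icc (0 : ℝ) (1 / 4))
    (hσ : 0 < ∑ i ∈ Finset.range n, a i) (k : ℤ) :
    lazyWalkMass a n k ≤ √Real.pi / (4 * √(∑ i ∈ Finset.range n, a i)) := by
  have hπ := Real.pi_pos
  have hbound : ∀ t ∈ Icc (-Real.pi) Real.pi, Real.cos (k * t) * lazyWalkCharFun a n t ≤
      Real.exp (-(4 * (∑ i ∈ Finset.range n, a i) / Real.pi ^ 2) * t ^ 2) := fun t ht ↦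
    (mul_le_of_le_one_left (lazyWalkCharFun_nonneg ha t) (Real.cos_le_one _)).trans
      (lazyWalkCharFun_le_exp ha (abs_le.2 ht))
  set σ := ∑ i ∈ Finset.range n, a i
  calc lazyWalkMass a n k
      = 1 / (2 * Real.pi) *
          ∫ t in -Real.pi..Real.pi, Real.cos (k * t) * lazyWalkCharFun a n t :=
        lazyWalkMass_eq_integral a n k
    _ ≤ 1 / (2 * Real.pi) *
          ∫ t in -Real.pi..Real.pi, Real.exp (-(4 * σ / Real.pi ^ 2) * t ^ 2) := by
        have hφ := continuous_lazyWalkCharFun a n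
        gcongr
        exact intervalIntegral.integral_mono_on (by linarith)
          ((by fun_prop : Continuous _).intervalIntegrable _ _)
          ((by fun_prop : Continuous _).intervalIntegrable _ _) hbound
    _ ≤ 1 / (2 * Real.pi) * √(Real.pi / (4 * σ / Real.pi ^ 2)) := by
        gcongr
        exact intervalIntegral_exp_neg_mul_sq_le (by positivity) hπ.le
    _ = √Real.pi / (4 * √σ) := by
        rw [show Real.pi / (4 * σ / Real.pi ^ 2) = Real.pi * (Real.pi / 2) ^ 2 / σ by
            field_simp; norm_num,
          Real.sqrt_div (by positivity), Real.sqrt_mul hπ.le, Real.sqrt_sq (by positivity)]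
        field_simp
        norm_num

end LazyWalk

section ExpectedSign

variable (β : ℕ → ℝ) (n m : ℕ) (k : ℤ)

theorem expectedSign_succ_left : expectedSign β (n + 1) m k =
    (1 - β n) * expectedSign β n m k + β n * expectedSign β n m (k + 1) := by
  rw [expectedSign]

theorem expectedSign_succ_right : expectedSign β n (m + 1) k =
    (1 - β m) * expectedSign β n m k + β m * expectedSign β n m (k - 1) := by
  induction n generalizing k with
  | zero => rw [expectedSign]
  | succ n ih =>
    simp only [expectedSign_succ_left, ih, add_sub_cancel_right, sub_add_cancel]
    ring

theorem expectedSign_neg : expectedSign β n m (-k) = -expectedSign β m n k := by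
  induction n generalizing m k with
  | zero =>
    induction m generalizing k with
    | zero => simp [expectedSign]
    | succ m ih =>
      rw [expectedSign_succ_right, expectedSign_succ_left, ih, ← neg_add', ih]
      ring
  | succ n ih =>
    rw [expectedSign_succ_right, expectedSign_succ_left, ih, show -k + 1 = -(k - 1) by ring, ih]
    ring

theorem expectedSign_self_zero : expectedSign β n n 0 = 0 :=
  self_eq_neg.1 <| by simpa only [neg_zero] using expectedSign_neg β n n 0

variable {k} in
theorem expectedSign_zero_right (hk : 0 < k) : expectedSign β n 0 k = 1 := by
  induction n generalizing k with
  | zero => simp [expectedSign, Int.sign_eq_one_of_pos hk]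
  | succ n ih =>
    rw [expectedSign_succ_left, ih hk, ih (by lia)]
    ring

theorem expectedSign_self_add_one_sub :
    expectedSign β n n (k + 1) - expectedSign β n n k =
      lazyWalkMass (fun i ↦ β i * (1 - β i)) n k
        + lazyWalkMass (fun i ↦ β i * (1 - β i)) n (k + 1) := by
  induction n generalizing k with
  | zero =>
    simp only [expectedSign, lazyWalkMass]
    obtain h | rfl | rfl | h : k < -1 ∨ k = -1 ∨ k = 0 ∨ 0 < k := by lia
    · simp [Int.sign_eq_neg_one_of_neg (by lia : k < 0),
        Int.sign_eq_neg_one_of_neg (by lia : k + 1 < 0), (by lia : k ≠ 0), (by lia : k + 1 ≠ 0)]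
    · simp
    · simp
    · simp [Int.sign_eq_one_of_pos h, Int.sign_eq_one_of_pos (by lia : 0 < k + 1),
        (by lia : k ≠ 0), (by lia : k + 1 ≠ 0)]
  | succ n ih =>
    have hpred := ih (k - 1)
    rw [sub_add_cancel] at hpred
    simp only [expectedSign_succ_left, expectedSign_succ_right, lazyWalkMass,
      add_sub_cancel_right]
    linear_combination (1 - 2 * (β n * (1 - β n))) * ih k
      + β n * (1 - β n) * (ih (k + 1) + hpred)

end ExpectedSign

theorem mul_one_sub_mem_Icc {t : ℝ} (ht : t ∈ Icc (0 : ℝ) 1) :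
    t * (1 - t) ∈ Icc (0 : ℝ) (1 / 4) :=
  ⟨mul_nonneg ht.1 (sub_nonneg.2 ht.2), by nlinarith [sq_nonneg (t - 1 / 2)]⟩

theorem expectedSign_self_one_le {β : ℕ → ℝ} (hβ : ∀ n, β n ∈ Icc (0 : ℝ) 1) {n : ℕ}
    (hσ : 0 < ∑ i ∈ Finset.range n, β i * (1 - β i)) :
    expectedSign β n n 1 ≤ √Real.pi / (2 * √(∑ i ∈ Finset.range n, β i * (1 - β i))) := by
  have hmass (k : ℤ) := lazyWalkMass_le (fun i ↦ mul_one_sub_mem_Icc (hβ i)) hσ k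
  have hdiff := expectedSign_self_add_one_sub β n 0
  rw [expectedSign_self_zero, sub_zero, zero_add] at hdiff
  calc expectedSign β n n 1
      ≤ √Real.pi / (4 * √(∑ i ∈ Finset.range n, β i * (1 - β i)))
        + √Real.pi / (4 * √(∑ i ∈ Finset.range n, β i * (1 - β i))) :=
        hdiff.trans_le (add_le_add (hmass 0) (hmass 1))
    _ = _ := by
        field_simp
        norm_num

theorem IsDivergenceRate.sub_le_sum_range {γ : ℕ → ℕ} {a : ℕ → ℝ} {c : ℝ}
    (hγ : IsDivergenceRate γ a) (ha : ∀ i, a i ∈ Icc 0 c) {k n : ℕ} (hn : γ k ≤ n) :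
    (k : ℝ) - c ≤ ∑ i ∈ Finset.range n, a i := by
  have hk := hγ k
  rw [Finset.sum_range_succ] at hk
  have hmono : ∑ i ∈ Finset.range (γ k), a i ≤ ∑ i ∈ Finset.range n, a i :=
    Finset.sum_le_sum_of_subset_of_nonneg (Finset.range_mono hn) fun i _ _ ↦ (ha i).1
  linarith [(ha (γ k)).2]

section KrasnoselskiiMann

variable {X : Type*} [NormedAddCommGroup X] [NormedSpace ℝ X]
  {C : Set X} {T : X → X} {β : ℕ → ℝ} {x₀ : X} {D b : ℝ}

theorem krasnoselskiiMann_mem (hC : Convex ℝ C) (hTC : MapsTo T C C)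
    (hβ : ∀ n, β n ∈ Icc (0 : ℝ) 1) (hx₀ : x₀ ∈ C) (n : ℕ) :
    krasnoselskiiMann T β x₀ n ∈ C := by
  induction n with
  | zero => exact hx₀
  | succ n ih => exact hC ih (hTC ih) (sub_nonneg.2 (hβ n).2) (hβ n).1 (sub_add_cancel _ _)

theorem norm_krasnoselskiiMann_succ_sub_le (T : X → X) (hβ : ∀ n, β n ∈ Icc (0 : ℝ) 1)
    (x₀ : X) (n : ℕ) (y : X) :
    ‖krasnoselskiiMann T β x₀ (n + 1) - y‖ ≤
      (1 - β n) * ‖krasnoselskiiMann T β x₀ n - y‖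
        + β n * ‖T (krasnoselskiiMann T β x₀ n) - y‖ := by
  have hsplit : krasnoselskiiMann T β x₀ (n + 1) - y =
      (1 - β n) • (krasnoselskiiMann T β x₀ n - y)
        + β n • (T (krasnoselskiiMann T β x₀ n) - y) := by
    rw [krasnoselskiiMann]
    module
  rw [hsplit, ← norm_smul_of_nonneg (sub_nonneg.2 (hβ n).2), ← norm_smul_of_nonneg (hβ n).1]
  exact norm_add_le _ _

theorem norm_krasnoselskiiMann_sub_le_of_image (hβ : ∀ n, β n ∈ Icc (0 : ℝ) 1) {m : ℕ}
    (himage : ∀ n ≥ m, ‖T (krasnoselskiiMann T β x₀ n) - krasnoselskiiMann T β x₀ m‖ ≤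
      D * expectedSign β n m 1) :
    ∀ n ≥ m, ‖krasnoselskiiMann T β x₀ n - krasnoselskiiMann T β x₀ m‖ ≤
      D * expectedSign β n m 0 := by
  intro n hn
  induction n, hn using Nat.le_induction with
  | base => simp [expectedSign_self_zero]
  | succ n hn ih =>
    have hprev := mul_le_mul_of_nonneg_left ih (sub_nonneg.2 (hβ n).2)
    have hstep := mul_le_mul_of_nonneg_left (himage n hn) (hβ n).1
    rw [expectedSign_succ_left, zero_add]
    linarith [norm_krasnoselskiiMann_succ_sub_le T hβ x₀ n (krasnoselskiiMann T β x₀ m)]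

theorem norm_image_krasnoselskiiMann_sub_le (hC : Convex ℝ C)
    (hD : ∀ x ∈ C, ∀ y ∈ C, ‖x - y‖ ≤ D) (hTC : MapsTo T C C)
    (hT : ∀ x ∈ C, ∀ y ∈ C, ‖T x - T y‖ ≤ ‖x - y‖) (hβ : ∀ n, β n ∈ Icc (0 : ℝ) 1)
    (hx₀ : x₀ ∈ C) (m : ℕ) :
    ∀ n ≥ m, ‖T (krasnoselskiiMann T β x₀ n) - krasnoselskiiMann T β x₀ m‖ ≤
      D * expectedSign β n m 1 := by
  have hmem := krasnoselskiiMann_mem hC hTC hβ hx₀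
  induction m with
  | zero =>
    intro n _
    rw [expectedSign_zero_right β n one_pos, mul_one]
    exact hD _ (hTC (hmem n)) _ hx₀
  | succ m ih =>
    intro n hn
    have hnm : m ≤ n := by lia
    have hprev := mul_le_mul_of_nonneg_left (ih n hnm) (sub_nonneg.2 (hβ m).2)
    have hstep := mul_le_mul_of_nonneg_left ((hT _ (hmem n) _ (hmem m)).trans
      (norm_krasnoselskiiMann_sub_le_of_image hβ ih n hnm)) (hβ m).1
    have hsucc := norm_krasnoselskiiMann_succ_sub_le T hβ x₀ m (T (krasnoselskiiMann T β x₀ n))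
    rw [norm_sub_rev, norm_sub_rev _ (T _), norm_sub_rev (T _) (T _)] at hsucc
    rw [expectedSign_succ_right, sub_self]
    linarith

theorem norm_krasnoselskiiMann_sub_image_le (hC : Convex ℝ C)
    (hD : ∀ x ∈ C, ∀ y ∈ C, ‖x - y‖ ≤ D) (hTC : MapsTo T C C)
    (hT : ∀ x ∈ C, ∀ y ∈ C, ‖T x - T y‖ ≤ ‖x - y‖) (hβ : ∀ n, β n ∈ Icc (0 : ℝ) 1)
    (hx₀ : x₀ ∈ C) {n : ℕ} (hσ : 0 < ∑ i ∈ Finset.range n, β i * (1 - β i)) :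
    ‖krasnoselskiiMann T β x₀ n - T (krasnoselskiiMann T β x₀ n)‖ ≤
      D * (√Real.pi / (2 * √(∑ i ∈ Finset.range n, β i * (1 - β i)))) := by
  have hD₀ : 0 ≤ D := (norm_nonneg _).trans (hD x₀ hx₀ x₀ hx₀)
  rw [norm_sub_rev]
  exact (norm_image_krasnoselskiiMann_sub_le hC hD hTC hT hβ hx₀ n n le_rfl).trans
    (mul_le_mul_of_nonneg_left (expectedSign_self_one_le hβ hσ) hD₀)

theorem mul_sqrt_pi_div_le {w σ : ℝ} (hb : 0 < b) (hw : 0 < w)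
    (hσ : 3 / 4 * (4 * b ^ 2 / (Real.pi * w ^ 2)) ≤ σ) :
    2 * b * (√Real.pi / (2 * √σ)) ≤ 2 * w := by
  have hπ := Real.pi_pos
  have hσ₀ : 0 < σ := lt_of_lt_of_le (by positivity) hσ
  have hbσ : 3 * b ^ 2 ≤ Real.pi * w ^ 2 * σ := by
    rw [← mul_div_assoc, div_le_iff₀ (by positivity)] at hσ
    linarith
  have hπsq : Real.pi ^ 2 ≤ 12 := by nlinarith [Real.pi_lt_d2]
  have hbπ : b ^ 2 * Real.pi ≤ 4 * w ^ 2 * σ := by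
    refine le_of_mul_le_mul_left ?_ hπ
    calc Real.pi * (b ^ 2 * Real.pi) = b ^ 2 * Real.pi ^ 2 := by ring
      _ ≤ b ^ 2 * 12 := by gcongr
      _ ≤ Real.pi * (4 * w ^ 2 * σ) := by linarith
  have hsqrt : b * √Real.pi ≤ 2 * w * √σ := by
    refine (sq_le_sq₀ (by positivity) (by positivity)).1 ?_
    rw [mul_pow, mul_pow, Real.sq_sqrt hπ.le, Real.sq_sqrt hσ₀.le]
    linarith
  rw [← mul_div_assoc, div_le_iff₀ (by positivity)]
  linarith

theorem norm_krasnoselskiiMann_sub_image_le_of_rate (hC : Convex ℝ C) (hb : 0 < b)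
    (hCb : ∀ x ∈ C, ∀ y ∈ C, ‖x - y‖ ≤ 2 * b) (hTC : MapsTo T C C)
    (hT : ∀ x ∈ C, ∀ y ∈ C, ‖T x - T y‖ ≤ ‖x - y‖) (hβ : ∀ n, β n ∈ Icc (0 : ℝ) 1)
    {γ : ℕ → ℕ} (hγ : IsDivergenceRate γ fun n ↦ β n * (1 - β n)) (hx₀ : x₀ ∈ C)
    {w : ℝ} (hw : 0 < w) {n : ℕ} (hn : γ ⌈4 * b ^ 2 / (Real.pi * w ^ 2)⌉₊ ≤ n) :
    ‖krasnoselskiiMann T β x₀ n - T (krasnoselskiiMann T β x₀ n)‖ ≤ 2 * w := by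
  have hq : 0 < 4 * b ^ 2 / (Real.pi * w ^ 2) := by positivity
  have hk_one : (1 : ℝ) ≤ ⌈4 * b ^ 2 / (Real.pi * w ^ 2)⌉₊ := by exact_mod_cast Nat.ceil_pos.2 hq
  have hk_le := Nat.le_ceil (4 * b ^ 2 / (Real.pi * w ^ 2))
  have hσ := hγ.sub_le_sum_range (fun i ↦ mul_one_sub_mem_Icc (hβ i)) hn
  exact (norm_krasnoselskiiMann_sub_image_le hC hCb hTC hT hβ hx₀ (by linarith)).trans
    (mul_sqrt_pi_div_le hb hw (by linarith))

theorem tendsto_krasnoselskiiMann_sub_image (hC : Convex ℝ C) (hb : 0 < b)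
    (hCb : ∀ x ∈ C, ∀ y ∈ C, ‖x - y‖ ≤ 2 * b) (hTC : MapsTo T C C)
    (hT : ∀ x ∈ C, ∀ y ∈ C, ‖T x - T y‖ ≤ ‖x - y‖) (hβ : ∀ n, β n ∈ Icc (0 : ℝ) 1)
    {γ : ℕ → ℕ} (hγ : IsDivergenceRate γ fun n ↦ β n * (1 - β n)) (hx₀ : x₀ ∈ C) :
    Tendsto (fun n ↦ krasnoselskiiMann T β x₀ n - T (krasnoselskiiMann T β x₀ n))
      atTop (𝓝 0) := by
  refine Metric.tendsto_atTop.2 fun ε hε ↦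
    ⟨γ ⌈4 * b ^ 2 / (Real.pi * (ε / 4) ^ 2)⌉₊, fun n hn ↦ ?_⟩
  have hres := norm_krasnoselskiiMann_sub_image_le_of_rate hC hb hCb hTC hT hβ hγ hx₀
    (by linarith : 0 < ε / 4) hn
  rw [dist_zero_right]
  linarith

end KrasnoselskiiMann

section Convergence

variable {X : Type*} [NormedAddCommGroup X] {C : Set X} {T : X → X} {ω : ℝ → ℝ} {ρ : ℝ → ℕ}
  {x : ℕ → X} {p : X}

theorem IsCauchyRate.cauchySeq (hx : IsCauchyRate ρ x) : CauchySeq x :=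
  Metric.cauchySeq_iff.2 fun ε hε ↦ ⟨ρ (ε / 2), fun m hm n hn ↦ by
    rw [dist_eq_norm]
    exact (hx (ε / 2) (half_pos hε) m hm n hn).trans_lt (half_lt_self hε)⟩

theorem exists_tendsto_fixedPoint (hC : IsComplete C) (hT : ContinuousOn T C)
    (hmem : ∀ n, x n ∈ C) (hx : CauchySeq x) (hres : Tendsto (fun n ↦ x n - T (x n)) atTop (𝓝 0)) :
    ∃ p ∈ C, T p = p ∧ Tendsto x atTop (𝓝 p) := by
  obtain ⟨p, hpC, hp⟩ := cauchySeq_tendsto_of_isComplete hC hmem hx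
  have hTp : Tendsto (fun n ↦ T (x n)) atTop (𝓝 (T p)) :=
    (hT p hpC).tendsto.comp (tendsto_nhdsWithin_iff.2 ⟨hp, Eventually.of_forall hmem⟩)
  exact ⟨p, hpC, (sub_eq_zero.1 (tendsto_nhds_unique (hp.sub hTp) hres)).symm, hp⟩

namespace IsUniquenessModulus

theorem of_norm_le (hpos : ∀ ε > 0, 0 < ω ε)
    (hclose : ∀ ε > 0, ∀ x ∈ C, ∀ y ∈ C, ‖y‖ ≤ ‖x‖ → ‖x - T x‖ ≤ ω ε → ‖y - T y‖ ≤ ω ε →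
      ‖x - y‖ ≤ ε) :
    IsUniquenessModulus T C ω := by
  refine ⟨hpos, fun ε hε x hx y hy hrx hry ↦ ?_⟩
  rcases le_total ‖y‖ ‖x‖ with hyx | hxy
  · exact hclose ε hε x hx y hy hyx hrx hry
  · rw [norm_sub_rev]
    exact hclose ε hε y hy x hx hxy hry hrx

theorem norm_fixedPoint_sub_image_le (hω : IsUniquenessModulus T C ω) (hp : T p = p) {ε : ℝ}
    (hε : 0 < ε) : ‖p - T p‖ ≤ ω ε := by
  rw [hp, sub_self, norm_zero]
  exact (hω.1 ε hε).le

theorem fixedPoint_unique (hω : IsUniquenessModulus T C ω) {q : X} (hpC : p ∈ C) (hp : T p = p)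
    (hqC : q ∈ C) (hq : T q = q) : q = p :=
  sub_eq_zero.1 <| norm_le_zero_iff.1 <| le_of_forall_pos_le_add fun ε hε ↦ by
    rw [zero_add]
    exact hω.2 ε hε q hqC p hpC (hω.norm_fixedPoint_sub_image_le hq hε)
      (hω.norm_fixedPoint_sub_image_le hp hε)

theorem isCauchyRate (hω : IsUniquenessModulus T C ω) (hmem : ∀ n, x n ∈ C)
    (hres : ∀ ε > 0, ∀ n ≥ ρ ε, ‖x n - T (x n)‖ ≤ ω ε) : IsCauchyRate ρ x :=
  fun ε hε n hn m hm ↦ hω.2 ε hε _ (hmem n) _ (hmem m) (hres ε hε n hn) (hres ε hε m hm)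

theorem isConvergenceRate (hω : IsUniquenessModulus T C ω) (hmem : ∀ n, x n ∈ C)
    (hres : ∀ ε > 0, ∀ n ≥ ρ ε, ‖x n - T (x n)‖ ≤ ω ε) (hpC : p ∈ C) (hp : T p = p) :
    IsConvergenceRate ρ x p :=
  fun ε hε n hn ↦ hω.2 ε hε _ (hmem n) p hpC (hres ε hε n hn)
    (hω.norm_fixedPoint_sub_image_le hp hε)

end IsUniquenessModulus

end Convergence

section UniformConvexity

variable {X : Type*} [NormedAddCommGroup X] [NormedSpace ℝ X] {η : ℝ → ℝ} {b ε t R : ℝ}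
  {x y z w : X}

theorem norm_midpoint_sub_left (x y : X) : ‖midpoint ℝ x y - x‖ = ‖x - y‖ / 2 := by
  rw [← dist_eq_norm, dist_midpoint_left, dist_eq_norm, Real.norm_two, inv_mul_eq_div]

theorem norm_midpoint_sub_right (x y : X) : ‖midpoint ℝ x y - y‖ = ‖x - y‖ / 2 := by
  rw [midpoint_comm, norm_midpoint_sub_left, norm_sub_rev]

theorem HasMonotoneFactor.mul_le_mul {s : ℝ} (h : HasMonotoneFactor η) (hs : 0 < s) (hst : s ≤ t)
    (ht : t ≤ 2) : t * η s ≤ s * η t := by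
  obtain ⟨η', hfac, hmono⟩ := h
  have hs' : s ∈ Ioc (0 : ℝ) 2 := ⟨hs, hst.trans ht⟩
  have ht' : t ∈ Ioc (0 : ℝ) 2 := ⟨hs.trans_le hst, ht⟩
  have := mul_le_mul_of_nonneg_left (hmono hs' ht' hst) (mul_pos hs ht'.1).le
  rw [hfac s hs', hfac t ht']
  linarith

namespace IsUniformConvexityModulus

theorem norm_midpoint_le (hη : IsUniformConvexityModulus X η) (ht : t ∈ Ioc (0 : ℝ) 2)
    (hR : 0 < R) (hx : ‖x‖ ≤ R) (hy : ‖y‖ ≤ R) (hxy : t * R ≤ ‖x - y‖) :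
    ‖midpoint ℝ x y‖ ≤ R * (1 - η t) := by
  have hscale (v : X) : ‖R⁻¹ • v‖ = ‖v‖ / R := by
    rw [norm_smul_of_nonneg (inv_nonneg.2 hR.le), inv_mul_eq_div]
  have h := hη.2 t ht (R⁻¹ • x) (R⁻¹ • y) (by rwa [hscale, div_le_one hR])
    (by rwa [hscale, div_le_one hR]) (by rwa [← smul_sub, hscale, le_div_iff₀ hR])
  rw [← smul_add, smul_comm, hscale, div_le_iff₀ hR] at h
  rw [midpoint_eq_smul_add, invOf_eq_inv, ← one_div]
  linarith

theorem norm_sub_le_of_mem_closedBalls (hη : IsUniformConvexityModulus X η)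
    (ht : t ∈ Ioc (0 : ℝ) 2) (hR : 0 < R) (hzx : ‖z - x‖ ≤ R) (hwx : ‖w - x‖ ≤ R)
    (hzy : ‖z - y‖ ≤ R) (hwy : ‖w - y‖ ≤ R) (hzw : t * R ≤ ‖z - w‖) :
    ‖x - y‖ ≤ 2 * (R * (1 - η t)) := by
  have hmid (v : X) (hzv : ‖z - v‖ ≤ R) (hwv : ‖w - v‖ ≤ R) :
      ‖midpoint ℝ z w - v‖ ≤ R * (1 - η t) := by
    have h := hη.norm_midpoint_le ht hR hzv hwv (by rwa [sub_sub_sub_cancel_right])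
    rwa [← vsub_eq_sub, ← vsub_eq_sub, ← midpoint_vsub_midpoint, midpoint_self, vsub_eq_sub] at h
  have htri := norm_sub_le_norm_sub_add_norm_sub x (midpoint ℝ z w) y
  rw [norm_sub_rev x (midpoint ℝ z w)] at htri
  linarith [hmid x hzx hwx, hmid y hzy hwy]

theorem half_mul_le_norm_sub_norm_midpoint (hη : IsUniformConvexityModulus X η) (hε : 0 < ε)
    (hxy : ε ≤ ‖x - y‖) (hyx : ‖y‖ ≤ ‖x‖) (hxb : ‖x‖ ≤ b) :
    ε / 2 * η (ε / b) ≤ ‖x‖ - ‖midpoint ℝ x y‖ := by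
  have hx : ε ≤ 2 * ‖x‖ := by linarith [norm_sub_le x y]
  have hb : 0 < b := by linarith
  have hεb : ε / b ∈ Ioc (0 : ℝ) 2 := ⟨by positivity, by rw [div_le_iff₀ hb]; linarith⟩
  have hεx : ε / b * ‖x‖ ≤ ‖x - y‖ := by
    rw [div_mul_eq_mul_div]
    exact (div_le_of_le_mul₀ hb.le hε.le (by gcongr)).trans hxy
  have hmid := hη.norm_midpoint_le hεb (by linarith) le_rfl hyx hεx
  have hηx := mul_le_mul_of_nonneg_right (by linarith : ε / 2 ≤ ‖x‖) (hη.1 _ hεb.1).1.le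
  linarith

theorem mul_le_norm_sub_norm_midpoint (hη : IsUniformConvexityModulus X η)
    (hη' : HasMonotoneFactor η) (hε : 0 < ε) (hxy : ε ≤ ‖x - y‖) (hyx : ‖y‖ ≤ ‖x‖)
    (hxb : ‖x‖ ≤ b) :
    b * η (ε / b) ≤ ‖x‖ - ‖midpoint ℝ x y‖ := by
  have hx : ε ≤ 2 * ‖x‖ := by linarith [norm_sub_le x y]
  have hx₀ : 0 < ‖x‖ := by linarith
  have hb : 0 < b := by linarith
  have hεx : ε / ‖x‖ ∈ Ioc (0 : ℝ) 2 := ⟨by positivity, by rwa [div_le_iff₀ hx₀]⟩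
  have hmid := hη.norm_midpoint_le hεx hx₀ le_rfl hyx (by rwa [div_mul_cancel₀ _ hx₀.ne'])
  have hfactor := hη'.mul_le_mul (by positivity : 0 < ε / b) (by gcongr) hεx.2
  have hbx : b * η (ε / b) ≤ ‖x‖ * η (ε / ‖x‖) := by
    have := mul_le_mul_of_nonneg_left hfactor (by positivity : 0 ≤ b * ‖x‖ / ε)
    field_simp at this
    linarith
  linarith

end IsUniformConvexityModulus

end UniformConvexity

section MidpointDisplacement

variable {X : Type*} [NormedAddCommGroup X] [NormedSpace ℝ X] {C : Set X} {T : X → X}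
  {η : ℝ → ℝ} {Ω : ℝ → ℝ → ℝ} {b c r t δ ε : ℝ} {x y z : X}

theorem norm_image_midpoint_sub_left_le (hC : Convex ℝ C)
    (hT : ∀ x ∈ C, ∀ y ∈ C, ‖T x - T y‖ ≤ ‖x - y‖) (hx : x ∈ C) (hy : y ∈ C)
    (hrx : ‖x - T x‖ ≤ r) : ‖T (midpoint ℝ x y) - x‖ ≤ ‖x - y‖ / 2 + r := by
  have htri := norm_sub_le_norm_sub_add_norm_sub (T (midpoint ℝ x y)) (T x) x
  have hTz := hT _ (hC.midpoint_mem hx hy) x hx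
  rw [norm_sub_rev (T x) x] at htri
  rw [norm_midpoint_sub_left] at hTz
  linarith

theorem norm_midpoint_sub_image_le (hC : Convex ℝ C)
    (hT : ∀ x ∈ C, ∀ y ∈ C, ‖T x - T y‖ ≤ ‖x - y‖) (hx : x ∈ C) (hy : y ∈ C)
    (hrx : ‖x - T x‖ ≤ r) :
    ‖midpoint ℝ x y - T (midpoint ℝ x y)‖ ≤ 2 * (‖x - y‖ / 2 + r) := by
  have htri := norm_sub_le_norm_sub_add_norm_sub (midpoint ℝ x y) x (T (midpoint ℝ x y))
  rw [norm_sub_rev x, norm_midpoint_sub_left] at htri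
  linarith [norm_image_midpoint_sub_left_le hC hT hx hy hrx, (norm_nonneg _).trans hrx]

namespace IsUniformConvexityModulus

theorem radius_mul_le_of_approxFixed (hη : IsUniformConvexityModulus X η) (hC : Convex ℝ C)
    (hT : ∀ x ∈ C, ∀ y ∈ C, ‖T x - T y‖ ≤ ‖x - y‖) (hx : x ∈ C) (hy : y ∈ C) (hxy : x ≠ y)
    (hrx : ‖x - T x‖ ≤ r) (hry : ‖y - T y‖ ≤ r) (ht : t ∈ Ioc (0 : ℝ) 2)
    (hz : t * (‖x - y‖ / 2 + r) ≤ ‖midpoint ℝ x y - T (midpoint ℝ x y)‖) :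
    (‖x - y‖ / 2 + r) * η t ≤ r := by
  have hd : 0 < ‖x - y‖ := norm_pos_iff.2 (sub_ne_zero.2 hxy)
  have hr : 0 ≤ r := (norm_nonneg _).trans hrx
  have hwy := norm_image_midpoint_sub_left_le hC hT hy hx hry
  rw [midpoint_comm, norm_sub_rev y x] at hwy
  have hlens := hη.norm_sub_le_of_mem_closedBalls ht (by linarith)
    (by linarith [norm_midpoint_sub_left x y])
    (norm_image_midpoint_sub_left_le hC hT hx hy hrx)
    (by linarith [norm_midpoint_sub_right x y]) hwy hz
  linarith

theorem norm_midpoint_sub_image_le_two_mul (hη : IsUniformConvexityModulus X η)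
    (hC : Convex ℝ C) (hT : ∀ x ∈ C, ∀ y ∈ C, ‖T x - T y‖ ≤ ‖x - y‖) (hx : x ∈ C) (hy : y ∈ C)
    (hxy : x ≠ y) (hrx : ‖x - T x‖ ≤ r) (hry : ‖y - T y‖ ≤ r) (ht : t ∈ Ioc (0 : ℝ) 2)
    (hz : t * (‖x - y‖ / 2 + r) ≤ ‖midpoint ℝ x y - T (midpoint ℝ x y)‖) (hrc : r ≤ c * η t) :
    ‖midpoint ℝ x y - T (midpoint ℝ x y)‖ ≤ 2 * c := by
  have hR := (hη.radius_mul_le_of_approxFixed hC hT hx hy hxy hrx hry ht hz).trans hrc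
  linarith [le_of_mul_le_mul_right hR (hη.1 t ht.1).1, norm_midpoint_sub_image_le hC hT hx hy hrx]

theorem norm_midpoint_sub_image_le_mul (hη : IsUniformConvexityModulus X η)
    (hη' : HasMonotoneFactor η) (hC : Convex ℝ C)
    (hT : ∀ x ∈ C, ∀ y ∈ C, ‖T x - T y‖ ≤ ‖x - y‖) (hx : x ∈ C) (hy : y ∈ C)
    (hxy : x ≠ y) (hrx : ‖x - T x‖ ≤ r) (hry : ‖y - T y‖ ≤ r) (ht : 0 < t)
    (hz : t * (‖x - y‖ / 2 + r) ≤ ‖midpoint ℝ x y - T (midpoint ℝ x y)‖) (hrc : r ≤ c * η t) :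
    ‖midpoint ℝ x y - T (midpoint ℝ x y)‖ ≤ t * c := by
  have hd : 0 < ‖x - y‖ := norm_pos_iff.2 (sub_ne_zero.2 hxy)
  have hr : 0 ≤ r := (norm_nonneg _).trans hrx
  have hsR := norm_midpoint_sub_image_le hC hT hx hy hrx
  have hradius (u : ℝ) := hη.radius_mul_le_of_approxFixed (t := u) hC hT hx hy hxy hrx hry
  have hR : 0 < ‖x - y‖ / 2 + r := by linarith
  set s := ‖midpoint ℝ x y - T (midpoint ℝ x y)‖
  set R := ‖x - y‖ / 2 + r
  have hts : t ≤ s / R := by rwa [le_div_iff₀ hR]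
  have hs2 : s / R ≤ 2 := by rwa [div_le_iff₀ hR]
  have hRη : R * η (s / R) ≤ r :=
    hradius _ ⟨ht.trans_le hts, hs2⟩ (div_mul_cancel₀ _ hR.ne').le
  refine le_of_mul_le_mul_right ?_ (hη.1 t ht).1
  calc s * η t = R * (s / R * η t) := by field_simp
    _ ≤ R * (t * η (s / R)) := mul_le_mul_of_nonneg_left (hη'.mul_le_mul ht hts hs2) hR.le
    _ = t * (R * η (s / R)) := by ring
    _ ≤ t * (c * η t) := mul_le_mul_of_nonneg_left (hRη.trans hrc) ht.le
    _ = t * c * η t := by ring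

end IsUniformConvexityModulus

namespace IsUniformAccretivityModulus

theorem lt_norm_sub_mul_norm_sub {A : Set (X × X)} (hΩ : IsUniformAccretivityModulus A Ω)
    {u v : X} (hxu : (x, u) ∈ A) (hyv : (y, v) ∈ A) (hb : 0 < b) (hxb : ‖x‖ ≤ b) (hyb : ‖y‖ ≤ b)
    (hδ : 0 < δ) (hgap : δ ≤ |‖x‖ - ‖y‖|) : Ω δ b < ‖x - y‖ * ‖u - v‖ := by
  obtain ⟨j, ⟨-, hj⟩, hacc⟩ := hΩ.2 x u y v hxu hyv b hb δ hδ
  rw [← (sq_eq_sq₀ (norm_nonneg _) (norm_nonneg _)).1 hj]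
  exact (hacc ⟨max_le hxb hyb, hgap⟩).trans_le ((le_abs_self _).trans (j.le_opNorm _))

theorem lt_norm_sub_image (hΩ : IsUniformAccretivityModulus (idSubGraph T C) Ω) (hb : 0 < b)
    (hx : x ∈ C) (hz : z ∈ C) (hxb : ‖x‖ ≤ b) (hzb : ‖z‖ ≤ b) (hxz : ‖x - z‖ ≤ b)
    (hδ : 0 < δ) (hgap : δ ≤ ‖x‖ - ‖z‖) (hrx : ‖x - T x‖ ≤ Ω δ b / (2 * b)) :
    Ω δ b / (2 * b) < ‖z - T z‖ := by
  have hlt : Ω δ b < b * (Ω δ b / (2 * b) + ‖z - T z‖) := calc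
    Ω δ b < ‖x - z‖ * ‖x - T x - (z - T z)‖ :=
        hΩ.lt_norm_sub_mul_norm_sub ⟨hx, rfl⟩ ⟨hz, rfl⟩ hb hxb hzb hδ
          (hgap.trans (le_abs_self _))
    _ ≤ b * (Ω δ b / (2 * b) + ‖z - T z‖) := by
        gcongr
        exact (norm_sub_le _ _).trans (by gcongr)
  have hhalf : b * (Ω δ b / (2 * b)) = Ω δ b / 2 := by field_simp
  rw [div_lt_iff₀ (by positivity)]
  linarith

theorem midpoint_displacement_bounds (hΩ : IsUniformAccretivityModulus (idSubGraph T C) Ω)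
    (hC : Convex ℝ C) (hb : 0 < b) (hCb : ∀ x ∈ C, ‖x‖ ≤ b) (hTC : MapsTo T C C) (hx : x ∈ C)
    (hy : y ∈ C) (hδ : 0 < δ) (hgap : δ ≤ ‖x‖ - ‖midpoint ℝ x y‖) (hrx : ‖x - T x‖ ≤ r)
    (hr : r ≤ Ω δ b / (2 * b)) :
    Ω δ b / (2 * b) < ‖midpoint ℝ x y - T (midpoint ℝ x y)‖ ∧
      Ω δ b / (8 * b ^ 2) ∈ Ioc (0 : ℝ) 2 ∧
      Ω δ b / (8 * b ^ 2) * (‖x - y‖ / 2 + r) ≤ ‖midpoint ℝ x y - T (midpoint ℝ x y)‖ := by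
  have hz := hC.midpoint_mem hx hy
  have hxy : ‖x - y‖ ≤ 2 * b := by linarith [norm_sub_le x y, hCb x hx, hCb y hy]
  have hs2 : ‖midpoint ℝ x y - T (midpoint ℝ x y)‖ ≤ 2 * b := by
    linarith [norm_sub_le (midpoint ℝ x y) (T (midpoint ℝ x y)), hCb _ hz, hCb _ (hTC hz)]
  have hxz : ‖x - midpoint ℝ x y‖ ≤ b := by
    rw [norm_sub_rev, norm_midpoint_sub_left]
    linarith
  have hs := hΩ.lt_norm_sub_image hb hx hz (hCb x hx) (hCb _ hz) hxz hδ hgap (hrx.trans hr)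
  have hW : 0 < Ω δ b / (2 * b) := div_pos (hΩ.1 δ hδ b hb) (by positivity)
  have ht : Ω δ b / (8 * b ^ 2) = Ω δ b / (2 * b) / (4 * b) := by
    field_simp
    ring
  have hR : ‖x - y‖ / 2 + r ≤ 3 * b := by linarith
  rw [ht]
  refine ⟨hs, ⟨by positivity, by rw [div_le_iff₀ (by positivity)]; linarith⟩, ?_⟩
  calc Ω δ b / (2 * b) / (4 * b) * (‖x - y‖ / 2 + r)
      ≤ Ω δ b / (2 * b) / (4 * b) * (3 * b) := by gcongr
    _ = 3 / 4 * (Ω δ b / (2 * b)) := by field_simp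
    _ ≤ _ := by linarith

end IsUniformAccretivityModulus

end MidpointDisplacement

section UniquenessModulus

variable {X : Type*} [NormedAddCommGroup X] [NormedSpace ℝ X] {A : Set (X × X)} {C : Set X}
  {T : X → X} {η : ℝ → ℝ} {Ω : ℝ → ℝ → ℝ} {b ε : ℝ}

theorem uniquenessModulus_pos (hη : IsUniformConvexityModulus X η)
    (hΩ : IsUniformAccretivityModulus A Ω) (hb : 0 < b) (hε : 0 < ε) :
    0 < uniquenessModulus η Ω b ε := by
  have hηε := (hη.1 (ε / b) (by positivity)).1
  have hW := hΩ.1 (ε / 2 * η (ε / b)) (by positivity) b hb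
  have hηW := (hη.1 (1 / (8 * b ^ 2) * Ω (ε / 2 * η (ε / b)) b) (by positivity)).1
  rw [uniquenessModulus]
  positivity

theorem improvedUniquenessModulus_pos (hη : IsUniformConvexityModulus X η)
    (hΩ : IsUniformAccretivityModulus A Ω) (hb : 0 < b) (hε : 0 < ε) :
    0 < improvedUniquenessModulus η Ω b ε := by
  have hηε := (hη.1 (ε / b) (by positivity)).1
  have hW := hΩ.1 (b * η (ε / b)) (by positivity) b hb
  have hηW := (hη.1 (Ω (b * η (ε / b)) b / (8 * b ^ 2)) (by positivity)).1
  exact lt_min (by positivity) (by positivity)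

theorem isUniquenessModulus_two_mul_uniquenessModulus (hη : IsUniformConvexityModulus X η)
    (hΩ : IsUniformAccretivityModulus (idSubGraph T C) Ω) (hC : Convex ℝ C) (hb : 0 < b)
    (hCb : ∀ x ∈ C, ‖x‖ ≤ b) (hTC : MapsTo T C C)
    (hT : ∀ x ∈ C, ∀ y ∈ C, ‖T x - T y‖ ≤ ‖x - y‖) :
    IsUniquenessModulus T C fun ε ↦ 2 * uniquenessModulus η Ω b ε := by
  refine .of_norm_le (fun ε hε ↦ mul_pos two_pos (uniquenessModulus_pos hη hΩ hb hε))
    fun ε hε x hx y hy hyx hrx hry ↦ ?_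
  by_contra! hlt
  have hne : x ≠ y := sub_ne_zero.1 (norm_pos_iff.1 (hε.trans hlt))
  have hgap := hη.half_mul_le_norm_sub_norm_midpoint hε hlt.le hyx (hCb x hx)
  have hr_eq : 2 * uniquenessModulus η Ω b ε = Ω (ε / 2 * η (ε / b)) b / (8 * b)
      * η (Ω (ε / 2 * η (ε / b)) b / (8 * b ^ 2)) := by
    rw [uniquenessModulus, one_div_mul_eq_div, one_div_mul_eq_div]
    ring
  have hδ : 0 < ε / 2 * η (ε / b) := mul_pos (by positivity) (hη.1 _ (by positivity)).1
  set δ := ε / 2 * η (ε / b)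
  have hW : 0 < Ω δ b := hΩ.1 δ hδ b hb
  have hquarter : Ω δ b / (2 * b) = 4 * (Ω δ b / (8 * b)) := by
    field_simp
    norm_num
  have hpos : 0 < Ω δ b / (8 * b) := by positivity
  have hr : 2 * uniquenessModulus η Ω b ε ≤ Ω δ b / (2 * b) := by
    rw [hr_eq]
    linarith [mul_le_of_le_one_right hpos.le (hη.1 (Ω δ b / (8 * b ^ 2)) (by positivity)).2]
  obtain ⟨hs, ht, hz⟩ := hΩ.midpoint_displacement_bounds hC hb hCb hTC hx hy hδ hgap hrx hr
  linarith [hη.norm_midpoint_sub_image_le_two_mul hC hT hx hy hne hrx hry ht hz hr_eq.le]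

theorem isUniquenessModulus_two_mul_improvedUniquenessModulus
    (hη : IsUniformConvexityModulus X η) (hη' : HasMonotoneFactor η)
    (hΩ : IsUniformAccretivityModulus (idSubGraph T C) Ω) (hC : Convex ℝ C) (hb : 0 < b)
    (hCb : ∀ x ∈ C, ‖x‖ ≤ b) (hTC : MapsTo T C C)
    (hT : ∀ x ∈ C, ∀ y ∈ C, ‖T x - T y‖ ≤ ‖x - y‖) :
    IsUniquenessModulus T C fun ε ↦ 2 * improvedUniquenessModulus η Ω b ε := by
  refine .of_norm_le (fun ε hε ↦ mul_pos two_pos (improvedUniquenessModulus_pos hη hΩ hb hε))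
    fun ε hε x hx y hy hyx hrx hry ↦ ?_
  by_contra! hlt
  have hne : x ≠ y := sub_ne_zero.1 (norm_pos_iff.1 (hε.trans hlt))
  have hgap := hη.mul_le_norm_sub_norm_midpoint hη' hε hlt.le hyx (hCb x hx)
  have hω_le_left : improvedUniquenessModulus η Ω b ε ≤
      b * η (Ω (b * η (ε / b)) b / (8 * b ^ 2)) := min_le_left _ _
  have hω_le_right : improvedUniquenessModulus η Ω b ε ≤
      Ω (b * η (ε / b)) b / (4 * b) := min_le_right _ _
  have hδ : 0 < b * η (ε / b) := mul_pos hb (hη.1 _ (by positivity)).1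
  set δ := b * η (ε / b)
  have hW : 0 < Ω δ b := hΩ.1 δ hδ b hb
  have hhalf : Ω δ b / (2 * b) = 2 * (Ω δ b / (4 * b)) := by
    field_simp
    norm_num
  obtain ⟨hs, ht, hz⟩ := hΩ.midpoint_displacement_bounds hC hb hCb hTC hx hy hδ hgap hrx
    (by linarith)
  have hs_le := hη.norm_midpoint_sub_image_le_mul hη' hC hT hx hy hne hrx hry ht.1 hz
    (by linarith : _ ≤ 2 * b * η (Ω δ b / (8 * b ^ 2)))
  have hscale : Ω δ b / (8 * b ^ 2) * (2 * b) = Ω δ b / (4 * b) := by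
    field_simp
    norm_num
  have hpos : 0 < Ω δ b / (4 * b) := by positivity
  linarith

end UniquenessModulus

theorem mainTheorem5_general {X : Type*} [NormedAddCommGroup X] [NormedSpace ℝ X]
    {C : Set X} (hC : Convex ℝ C) {b : ℝ} (hb : 0 < b)
    (hCb : ∀ x ∈ C, ∀ y ∈ C, ‖x - y‖ ≤ 2 * b)
    {T : X → X} (hTC : MapsTo T C C) (hT : ∀ x ∈ C, ∀ y ∈ C, ‖T x - T y‖ ≤ ‖x - y‖)
    {ω : ℝ → ℝ} (hω : IsUniquenessModulus T C fun ε ↦ 2 * ω ε)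
    {β : ℕ → ℝ} (hβ : ∀ n, β n ∈ Icc (0 : ℝ) 1)
    {γ : ℕ → ℕ} (hγ : IsDivergenceRate γ fun n ↦ β n * (1 - β n)) {x₀ : X} (hx₀ : x₀ ∈ C) :
    CauchySeq (krasnoselskiiMann T β x₀) ∧
    IsCauchyRate (kmRate γ b ω) (krasnoselskiiMann T β x₀) ∧
    (IsComplete C →
      ∃ p ∈ C, T p = p ∧ (∀ q ∈ C, T q = q → q = p) ∧
        Tendsto (krasnoselskiiMann T β x₀) atTop (𝓝 p) ∧
        IsConvergenceRate (kmRate γ b ω) (krasnoselskiiMann T β x₀) p) := by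
  have hmem := krasnoselskiiMann_mem hC hTC hβ hx₀
  have hres : ∀ ε > 0, ∀ n ≥ kmRate γ b ω ε,
      ‖krasnoselskiiMann T β x₀ n - T (krasnoselskiiMann T β x₀ n)‖ ≤ 2 * ω ε := fun ε hε n hn ↦
    norm_krasnoselskiiMann_sub_image_le_of_rate hC hb hCb hTC hT hβ hγ hx₀
      (pos_of_mul_pos_right (hω.1 ε hε) zero_le_two) hn
  have hrate := hω.isCauchyRate hmem hres
  refine ⟨hrate.cauchySeq, hrate, fun hcomplete ↦ ?_⟩
  have hTcont : ContinuousOn T C :=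
    (LipschitzOnWith.mk_one fun x hx y hy ↦ by simpa only [dist_eq_norm] using hT x hx y hy
      ).continuousOn
  obtain ⟨p, hpC, hp, hlim⟩ := exists_tendsto_fixedPoint hcomplete hTcont hmem hrate.cauchySeq
    (tendsto_krasnoselskiiMann_sub_image hC hb hCb hTC hT hβ hγ hx₀)
  exact ⟨p, hpC, hp, fun q hqC hq ↦ hω.fixedPoint_unique hpC hp hqC hq, hlim,
    hω.isConvergenceRate hmem hres hpC hp⟩

theorem mainTheorem5 {X : Type*} [NormedAddCommGroup X] [NormedSpace ℝ X]
    (C : Set X) (hC : Convex ℝ C)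
    (b : ℝ) (hb : 0 < b) (hCb : ∀ x ∈ C, ‖x‖ ≤ b)
    (η : ℝ → ℝ) (hη : IsUniformConvexityModulus X η)
    (T : X → X) (hTC : MapsTo T C C) (hT : ∀ x ∈ C, ∀ y ∈ C, ‖T x - T y‖ ≤ ‖x - y‖)
    (Ω : ℝ → ℝ → ℝ) (hΩ : IsUniformAccretivityModulus (idSubGraph T C) Ω)
    (β : ℕ → ℝ) (hβ : ∀ n, β n ∈ Icc (0 : ℝ) 1)
    (γ : ℕ → ℕ) (hγ : IsDivergenceRate γ (fun n => β n * (1 - β n)))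
    (x₀ : X) (hx₀ : x₀ ∈ C)
    (ω : ℝ → ℝ)
    (hω : ω = uniquenessModulus η Ω b ∨
      (HasMonotoneFactor η ∧ ω = improvedUniquenessModulus η Ω b)) :
    CauchySeq (krasnoselskiiMann T β x₀) ∧
    IsCauchyRate (kmRate γ b ω) (krasnoselskiiMann T β x₀) ∧
    (CompleteSpace X → IsClosed C →
      ∃ p ∈ C, T p = p ∧ (∀ q ∈ C, T q = q → q = p) ∧
        Tendsto (krasnoselskiiMann T β x₀) atTop (𝓝 p) ∧
        IsConvergenceRate (kmRate γ b ω) (krasnoselskiiMann T β x₀) p) := by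
  have hdiam : ∀ x ∈ C, ∀ y ∈ C, ‖x - y‖ ≤ 2 * b := fun x hx y hy ↦ by
    linarith [norm_sub_le x y, hCb x hx, hCb y hy]
  have hmodulus : IsUniquenessModulus T C fun ε ↦ 2 * ω ε := by
    rcases hω with rfl | ⟨hη', rfl⟩
    · exact isUniquenessModulus_two_mul_uniquenessModulus hη hΩ hC hb hCb hTC hT
    · exact isUniquenessModulus_two_mul_improvedUniquenessModulus hη hη' hΩ hC hb hCb hTC hT
  obtain ⟨hcauchy, hrate, hlim⟩ := mainTheorem5_general hC hb hdiam hTC hT hmodulus hβ hγ hx₀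
  exact ⟨hcauchy, hrate, fun _ hclosed ↦ hlim hclosed.isComplete⟩
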